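/- **Model.** An access point with $M_t\ge 1$ transmit antennas and transmit power $P>0$ wirelessly powers a finite non-empty set of nodes $s_i$ with channel gains $\beta_i>0$; let $s_{i'}$ be a node with $\beta_{i'}=\min_i\beta_i$. In the coherence interval $\tau$ (of length $T_c>0$) the downlink channel of $s_i$ is $\mathbf h_{i,\tau}\sim\mathcal{CN}\big(\sqrt{\tfrac{\kappa}{1+\kappa}}\,\mathbf 1,\tfrac1{1+\kappa}\mathbf I\big)$ on $\mathbb C^{M_t}$, $\kappa\ge0$, independent over $\tau$. With precoders $\mathbf w_{1,\tau},\dots,\mathbf w_{M_t,\tau}\in\mathbb C^{M_t}$ (random vectors that may depend on all the channels, with $\sum_j\|\mathbf w_{j,\tau}\|^2\le1$), the incident RF power at $s_i$ is $E^{\rm rf}_{i,\tau}=P\beta_i\sum_j|\mathbf h_{i,\tau}^T\mathbf w_{j,\tau}|^2$. The messages of $s_i$ have an exponential inter-arrival time $U_i$ with mean $1/\lambda$ coherence intervals ($\lambda>0$), independent of the channels of $s_i$, and $V_i\in\{1,2,\dots\}$ is defined by $V_i-1\le U_i<V_i$. Between two uplink transmissions the node harvests $E_i=\eta T_c\sum_{\tau=1}^{V_i}E^{\rm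 rf}_{i,\tau}$, $\eta\in(0,1)$, and requires $E_0(V_i)$, where $E_0(v)=v(\xi_d+p_cT_c)+\xi_u+pt$ with $\xi_d,\xi_u,p_c,p\ge0$, $t>0$. Its energy outage probability is $\mathcal O_i=\mathbb P[E_i<E_0(V_i)]$. Maximum ratio transmission (MRT) towards $s_{i'}$ is $\mathbf w_{j,\tau}=\mathbf h_{i',\tau}^*/(\sqrt{M_t}\,\|\mathbf h_{i',\tau}\|)$ for all $j$. Let $\mathcal Q_m(a,b)=\int_b^\infty x(x/a)^{m-1}e^{-(x^2+a^2)/2}I_{m-1}(ax)\,dx$ be the generalized Marcum Q-function (extended by continuity to $a=0$), and put $$B(v_{\max})=1-(e^\lambda-1)\sum_{v=1}^{v_{\max}}e^{-\lambda v}\,\mathcal Q_{M_tv}\Big(\sqrt{2M_t\kappa v},\ \sqrt{\tfrac{2(1+\kappa)}{\eta T_cP\beta_{i'}}}\,\sqrt{v(\xi_d+p_cT_c)+\xi_u+pt}\Big).$$ **Theorem.** 1. $\mathbb P[V_i=v]=(e^\lambda-1)e^{-\lambda v}$ for all $v\ge1$ and all $i$. 2. Under MRT towards $s_{i'}$, $E_{i'}=\eta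 T_c\sum_{\tau=1}^{V_{i'}}E^{\rm rf}_{i',\tau}$ is a random sum whose terms $E^{\rm rf}_{i',\tau}$ are independent, independent of $V_{i'}$, and distributed as $\frac{P\beta_{i'}}{2(1+\kappa)}\chi^2(2M_t,2M_t\kappa)$ (non-central chi-squared with $2M_t$ degrees of freedom and non-centrality $2M_t\kappa$). 3. Let $\mathcal O^\star$ be the energy outage probability of $s_{i'}$ under MRT towards $s_{i'}$. It is the minimum of $\mathcal O_{i'}$ over all precoders, so $\sup_i\mathcal O_i\ge\mathcal O^\star$ for all precoders. Moreover $B(v_{\max})\to\mathcal O^\star$ as $v_{\max}\to\infty$, with $\mathcal O^\star\le B(v_{\max})\le\mathcal O^\star+e^{-\lambda v_{\max}}$ for every $v_{\max}\ge0$. Hence $B(v_{\max})$ is an approximate lower bound on the worst-node energy outage: for all precoders and all $v_{\max}\ge 0$, $$\sup_i\mathcal O_i\ \ge\ B(v_{\max})-e^{-\lambda v_{\max}},$$ and in particular $\sup_i\mathcal O_i\ge B(v_{\max})-e^{-10}$ whenever $v_{\max}\ge10\,\frac{e^\lambda}{e^\lambda-1}$. -/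

import Mathlib

open MeasureTheory ProbabilityTheory Filter Topology

noncomputable section

namespace WPCN

/-- The modified Bessel function of the first kind `I_n` of integer order `n ≥ 0`. -/
def besselI (n : ℕ) (z : ℝ) : ℝ :=
  ∑' k : ℕ, (z / 2) ^ (2 * k + n) / ((k.factorial : ℝ) * ((k + n).factorial : ℝ))

/-- The generalized Marcum function `Q_m(a, b)` of integer order `m ≥ 1`, for `a, b ≥ 0`:
`∫_b^∞ x (x/a)^(m-1) exp(-(x²+a²)/2) I_{m-1}(a x) dx`, where for `a = 0` the integrand is
understood as its limit `x^(2m-1) exp(-x²/2) / (2^(m-1) (m-1)!)` for `a → 0`. -/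
def marcumQ (m : ℕ) (a b : ℝ) : ℝ :=
  if a = 0 then
    ∫ x in Set.Ioi b,
      x ^ (2 * m - 1) * Real.exp (-x ^ 2 / 2) / (2 ^ (m - 1) * ((m - 1).factorial : ℝ))
  else
    ∫ x in Set.Ioi b,
      x * (x / a) ^ (m - 1) * Real.exp (-(x ^ 2 + a ^ 2) / 2) * besselI (m - 1) (a * x)

/-- The non-central chi-squared law with `n ≥ 1` degrees of freedom and non-centrality `ψ ≥ 0`:
the law of `∑ X_k²` for independent unit-variance normal `X_1, …, X_n` whose means have squares
adding up to `ψ` (the law depends on the means only through that sum; here they are all equal). -/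
def noncentralChiSq (n : ℕ) (ψ : ℝ) : Measure ℝ :=
  (Measure.pi fun _ : Fin n => gaussianReal (Real.sqrt (ψ / n)) 1).map fun x => ∑ k, x k ^ 2

/-- The circularly-symmetric complex normal law on `ℂ` with mean `m` and variance `v`: real and
imaginary part are independent normal, each of variance `v / 2`. -/
def complexNormal (m : ℂ) (v : ℝ) : Measure ℂ :=
  ((gaussianReal m.re (v / 2).toNNReal).prod (gaussianReal m.im (v / 2).toNNReal)).map
    Complex.measurableEquivRealProd.symm

/-- The Rician fading law `CN(√(κ/(1+κ)) 1, (1/(1+κ)) I)` on `ℂ^M`. -/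
def ricianLaw (M : ℕ) (κ : ℝ) : Measure (EuclideanSpace ℂ (Fin M)) :=
  (Measure.pi fun _ : Fin M =>
    complexNormal ((Real.sqrt (κ / (1 + κ)) : ℝ) : ℂ) (1 / (1 + κ))).map (WithLp.toLp 2)

/-- The parameters of the network with set of nodes `ι`. -/
structure Network (ι : Type*) where
  /-- number of transmit antennas -/
  Mt : ℕ
  /-- average channel gain of each node -/
  β : ι → ℝ
  /-- Rician factor -/
  κ : ℝ
  /-- transmit power of the access point -/
  P : ℝ
  /-- energy conversion efficiency -/
  η : ℝ
  /-- coherence time -/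
  Tc : ℝ
  /-- duration of an uplink transmission -/
  t : ℝ
  /-- power that a node needs to keep active -/
  pc : ℝ
  /-- uplink transmit power of a node -/
  p : ℝ
  /-- energy spent by a node on downlink CSI, in each coherence interval -/
  ξd : ℝ
  /-- energy spent by a node on uplink CSI, in each uplink transmission -/
  ξu : ℝ
  /-- mean number of messages per coherence interval -/
  lam : ℝ
  Mt_pos : 0 < Mt
  β_pos : ∀ i, 0 < β i
  κ_nonneg : 0 ≤ κ
  P_pos : 0 < P
  η_pos : 0 < η
  η_lt_one : η < 1
  Tc_pos : 0 < Tc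
  t_pos : 0 < t
  pc_nonneg : 0 ≤ pc
  p_nonneg : 0 ≤ p
  ξd_nonneg : 0 ≤ ξd
  ξu_nonneg : 0 ≤ ξu
  lam_pos : 0 < lam

variable {ι Ω : Type*} [MeasurableSpace Ω]

/-- The energy that a node needs between two of its uplink transmissions when these are `v`
coherence intervals apart. -/
def Network.requiredEnergy (S : Network ι) (v : ℕ) : ℝ :=
  v * S.ξd + S.ξu + S.pc * (v * S.Tc) + S.p * S.t

/-- The random model: `h i τ` is the downlink channel of node `i` in the coherence interval `τ`,
and `U i` is the inter-arrival time of the messages of node `i`, in coherence intervals. Channels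
of a node in different intervals are independent, and independent of its traffic. Nothing is
assumed on the joint law of different nodes. -/
structure Network.IsPoissonModel (S : Network ι)
    (h : ι → ℕ → Ω → EuclideanSpace ℂ (Fin S.Mt)) (U : ι → Ω → ℝ) (μ : Measure Ω) : Prop where
  measurable_channel : ∀ i τ, Measurable (h i τ)
  law_channel : ∀ i τ, μ.map (h i τ) = ricianLaw S.Mt S.κ
  indep_channel : ∀ i, iIndepFun (h i) μ
  measurable_arrival : ∀ i, Measurable (U i)
  law_arrival : ∀ i, μ.map (U i) = expMeasure S.lam
  indep_arrival : ∀ i, IndepFun (U i) (fun ω τ => h i τ ω) μ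

/-- The slotted inter-arrival count: the `v ≥ 1` with `v - 1 ≤ u < v`, for `u ≥ 0`. -/
def slotted (u : ℝ) : ℕ := ⌊u⌋₊ + 1

/-- A sequence of precoders: `w τ ω j` is the vector of the `j`-th energy beam in the coherence
interval `τ`. It may depend in any measurable way on the channels of all nodes (and on anything
else), within the power budget `∑ j, ‖w_j‖² ≤ 1`. -/
structure IsPrecoder {M : ℕ} (w : ℕ → Ω → Fin M → EuclideanSpace ℂ (Fin M)) : Prop where
  measurable : ∀ τ j, Measurable fun ω => w τ ω j
  power_le_one : ∀ τ ω, ∑ j, ‖w τ ω j‖ ^ 2 ≤ 1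

/-- The RF power `P β_i ∑ j, |h_iᵀ w_j|²` incident at a node of gain `β_i` and channel `h_i`. -/
def Network.rfPower (S : Network ι) (i : ι) (hi : EuclideanSpace ℂ (Fin S.Mt))
    (w : Fin S.Mt → EuclideanSpace ℂ (Fin S.Mt)) : ℝ :=
  S.P * S.β i * ∑ j, ‖∑ k, hi k * w j k‖ ^ 2

/-- The energy harvested by a node from the first `v` coherence intervals, given its channels and
the precoders: `η T_c ∑_{τ < v} E^rf_τ`. -/
def Network.harvested (S : Network ι) (i : ι) (hi : ℕ → EuclideanSpace ℂ (Fin S.Mt))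
    (w : ℕ → Fin S.Mt → EuclideanSpace ℂ (Fin S.Mt)) (v : ℕ) : ℝ :=
  S.η * S.Tc * ∑ τ ∈ Finset.range v, S.rfPower i (hi τ) (w τ)

/-- The energy outage probability of node `i` under the precoders `w`. -/
def Network.outage (S : Network ι) (h : ι → ℕ → Ω → EuclideanSpace ℂ (Fin S.Mt))
    (U : ι → Ω → ℝ) (μ : Measure Ω) (w : ℕ → Ω → Fin S.Mt → EuclideanSpace ℂ (Fin S.Mt))
    (i : ι) : ℝ :=
  μ.real {ω | S.harvested i (fun τ => h i τ ω) (fun τ => w τ ω) (slotted (U i ω)) <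
    S.requiredEnergy (slotted (U i ω))}

/-- Maximum ratio transmission towards a channel `h`: every beam is `h^* / (√M ‖h‖)`. -/
def mrt {M : ℕ} (h : EuclideanSpace ℂ (Fin M)) : Fin M → EuclideanSpace ℂ (Fin M) :=
  fun _ => WithLp.toLp 2 fun k => star (h k) / ((Real.sqrt M * ‖h‖ : ℝ) : ℂ)

/-- `1 - (e^λ - 1) ∑_{v=1}^{vmax} e^{-λ v} Q_{M_t v}(√(2 M_t κ v), √(2(1+κ)/(η T_c P β_i)) √E_0(v))`
with `E_0(v) = v (ξd + p_c T_c) + ξu + p t`. -/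
def Network.truncatedBound (S : Network ι) (i : ι) (vmax : ℕ) : ℝ :=
  1 - (Real.exp S.lam - 1) * ∑ v ∈ Finset.Icc 1 vmax, Real.exp (-S.lam * v) *
    marcumQ (S.Mt * v) (Real.sqrt (2 * S.Mt * S.κ * v))
      (Real.sqrt (2 * (1 + S.κ) / (S.η * S.Tc * S.P * S.β i)) *
        Real.sqrt (v * (S.ξd + S.pc * S.Tc) + S.ξu + S.p * S.t))

end WPCN

end

/-!
Under MRT towards a node, the RF power incident there is `P β ‖h‖²`, and by the Cauchy–Schwarz
inequality no precoder delivers more, pointwise in `ω`. So MRT minimizes the outage probability of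
that node (`Network.outage_mrt_le`), and the worst node fares no better than that minimum.

All distributions are identified through characteristic functions. Completing the square in a
Gaussian integral shows that both `noncentralChiSq (2 m) ψ` and the scaled squared norm of a Rician
channel have the characteristic function `(1 - 2it)^(-m) exp(iψt / (1 - 2it))`
(`charFun_noncentralChiSq`, `charFun_sq_norm_ricianLaw`). It is multiplicative in `(m, ψ)`, so the
energy collected over `v` independent intervals is of the same type, with parameters `(m v, ψ v)`.
Expanding the exponential, it is also the characteristic function of a Poisson mixture of central
chi-squared laws (`charFun_sq_chiMixture`). The density of that mixture is, after the power series
of the Bessel function is written out, the integrand of the Marcum function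
(`marcumQ_eq_integral_tsum`). Hence the Marcum function is the tail of the law of the collected
energy (`measureReal_le_sum_sq_norm`).

Since the traffic is independent of the channels, the `v`-th summand of the truncated bound is the
probability that `v` intervals elapse and the energy suffices. Therefore the truncated bound exceeds
the outage probability exactly by the probability that the node succeeds after more than `vmax`
intervals (`Network.IsPoissonModel.truncatedBound_eq`), which lies between `0` and `e^(-λ vmax)`.
-/

open Complex (I)

namespace WPCN

/-! ### Characteristic functions of squared Gaussian norms -/

/-- The characteristic function of the non-central chi-squared law with `2 m` degrees of freedom and
non-centrality `ψ`. -/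
noncomputable def chiSqCharFun (m : ℕ) (ψ t : ℝ) : ℂ :=
  (1 - 2 * t * I)⁻¹ ^ m * Complex.exp (ψ * (t * I / (1 - 2 * t * I)))

lemma one_sub_mul_I_ne_zero (t : ℝ) : (1 - 2 * t * I : ℂ) ≠ 0 := by
  intro h
  simpa using congrArg Complex.re h

lemma chiSqCharFun_pow (m n : ℕ) (ψ t : ℝ) :
    chiSqCharFun m ψ t ^ n = chiSqCharFun (m * n) (ψ * n) t := by
  rw [chiSqCharFun, chiSqCharFun, mul_pow, ← pow_mul, ← Complex.exp_nat_mul]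
  push_cast
  ring_nf

/-- The prefactor `A = (1 - 2 v s i)^(-1/2)` does not depend on the mean; only its square
is needed, since the squares occur in pairs below. -/
lemma exists_integral_cexp_sq_gaussianReal (v : NNReal) (hv : v ≠ 0) (s : ℝ) :
    ∃ A : ℂ, A ^ 2 = (1 - 2 * (v * s : ℝ) * I)⁻¹ ∧
      ∀ m : ℝ, ∫ x : ℝ, Complex.exp (s * x ^ 2 * I) ∂(gaussianReal m v) =
        A * Complex.exp (m ^ 2 * (s * I / (1 - 2 * (v * s : ℝ) * I))) := by
  have hv' : (0 : ℝ) < v := by positivity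
  have hvc : ((v : ℝ) : ℂ) ≠ 0 := by exact_mod_cast hv'.ne'
  set b : ℂ := s * I - 1 / (2 * (v : ℝ)) with hb
  have hbre : b.re < 0 := by
    have : b.re = - (1 / (2 * (v : ℝ))) := by
      rw [hb, show ((1 : ℂ) / (2 * (v : ℝ))) = ((1 / (2 * (v : ℝ)) : ℝ) : ℂ) by push_cast; rfl]
      simp only [Complex.sub_re, Complex.mul_re, Complex.ofReal_re, Complex.ofReal_im, Complex.I_re,
        Complex.I_im]
      ring
    rw [this]
    have : 0 < 1 / (2 * (v : ℝ)) := by positivity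
    linarith
  have hD := one_sub_mul_I_ne_zero (v * s)
  have hbD : b = - ((1 - 2 * (v * s : ℝ) * I) / (2 * (v : ℝ))) := by
    rw [hb]; push_cast; field_simp; ring
  have hb0 : b ≠ 0 := by
    rw [hbD]; exact neg_ne_zero.2 (div_ne_zero hD (mul_ne_zero two_ne_zero hvc))
  have hπ : (Real.pi : ℂ) ≠ 0 := by exact_mod_cast Real.pi_ne_zero
  refine ⟨((Real.sqrt (2 * Real.pi * v))⁻¹ : ℝ) * (Real.pi / -b) ^ (1 / 2 : ℂ), ?_, fun m => ?_⟩
  · rw [mul_pow, ← Complex.ofReal_pow, inv_pow, Real.sq_sqrt (by positivity),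
      ← Complex.cpow_nat_mul]
    norm_num
    rw [hbD]
    push_cast
    push_cast at hD
    field_simp
  · rw [integral_gaussianReal_eq_integral_smul hv]
    have h1 : ∀ x : ℝ, gaussianPDFReal m v x • Complex.exp (s * x ^ 2 * I) =
        ((Real.sqrt (2 * Real.pi * v))⁻¹ : ℝ) *
          Complex.exp (b * x ^ 2 + (m / (v : ℝ)) * x + (-(m ^ 2 / (2 * (v : ℝ))))) := by
      intro x
      rw [gaussianPDFReal, Complex.real_smul, Complex.ofReal_mul, mul_assoc, Complex.ofReal_exp,
        ← Complex.exp_add]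
      congr 2
      rw [hb]; push_cast; field_simp; ring
    simp_rw [h1]
    rw [integral_const_mul, integral_cexp_quadratic hbre, ← mul_assoc]
    congr 2
    rw [hbD]
    push_cast
    push_cast at hD
    generalize hd : (1 - 2 * (((v : ℝ) : ℂ) * s) * I) = d at hD ⊢
    field_simp
    rw [← hd]
    ring

lemma charFun_noncentralChiSq (m : ℕ) (hm : 0 < m) {ψ : ℝ} (hψ : 0 ≤ ψ) (t : ℝ) :
    charFun (noncentralChiSq (2 * m) ψ) t = chiSqCharFun m ψ t := by
  obtain ⟨A, hA, hG⟩ := exists_integral_cexp_sq_gaussianReal 1 one_ne_zero t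
  rw [charFun_apply_real, noncentralChiSq,
    integral_map (Measurable.aemeasurable (by fun_prop)) (by fun_prop)]
  have : ∀ x : Fin (2 * m) → ℝ, Complex.exp (t * (∑ k, x k ^ 2 : ℝ) * I) =
      ∏ k, Complex.exp (t * x k ^ 2 * I) := by
    intro x
    rw [← Complex.exp_sum, ← Finset.sum_mul, ← Finset.mul_sum]
    push_cast
    rfl
  simp_rw [this]
  rw [integral_fintype_prod_eq_pow (fun x : ℝ => Complex.exp (t * x ^ 2 * I)), hG, mul_pow,
    Fintype.card_fin, pow_mul, hA, chiSqCharFun, ← Complex.exp_nat_mul, ← Complex.ofReal_pow,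
    Real.sq_sqrt (by positivity)]
  have : (m : ℂ) ≠ 0 := by exact_mod_cast hm.ne'
  congr 2
  · simp
  · push_cast
    simp only [one_mul]
    field_simp

lemma charFun_sq_norm_ricianLaw (M : ℕ) {κ : ℝ} (hκ : 0 ≤ κ) (t : ℝ) :
    charFun ((ricianLaw M κ).map fun h => 2 * (1 + κ) * ‖h‖ ^ 2) t =
      chiSqCharFun M (2 * M * κ) t := by
  have hκ1 : 0 < 1 + κ := by linarith
  set v : NNReal := (1 / (1 + κ) / 2).toNNReal with hv
  have hvr : (v : ℝ) = 1 / (1 + κ) / 2 := Real.coe_toNNReal _ (by positivity)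
  have hv0 : v ≠ 0 := by
    rw [hv, ne_eq, Real.toNNReal_eq_zero, not_le]; positivity
  obtain ⟨A, hA, hG⟩ := exists_integral_cexp_sq_gaussianReal v hv0 (t * (2 * (1 + κ)))
  have hvs : (v : ℝ) * (t * (2 * (1 + κ))) = t := by
    rw [hvr]; field_simp
  rw [hvs] at hA hG
  have hone : ∫ z : ℂ, Complex.exp (t * (2 * (1 + κ) * ‖z‖ ^ 2 : ℝ) * I)
      ∂(complexNormal ((Real.sqrt (κ / (1 + κ)) : ℝ) : ℂ) (1 / (1 + κ))) =
      chiSqCharFun 1 (2 * κ) t := by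
    rw [complexNormal, integral_map_equiv]
    have : ∀ p : ℝ × ℝ, Complex.exp (t * (2 * (1 + κ) *
        ‖Complex.measurableEquivRealProd.symm p‖ ^ 2 : ℝ) * I) =
        Complex.exp ((t * (2 * (1 + κ)) : ℝ) * p.1 ^ 2 * I) *
          Complex.exp ((t * (2 * (1 + κ)) : ℝ) * p.2 ^ 2 * I) := by
      intro p
      rw [← Complex.exp_add, ← Complex.normSq_eq_norm_sq, Complex.normSq_apply,
        Complex.measurableEquivRealProd_symm_apply]
      congr 1
      push_cast
      ring
    simp_rw [this]
    rw [integral_prod_mul (fun x : ℝ => Complex.exp ((t * (2 * (1 + κ)) : ℝ) * x ^ 2 * I))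
      (fun x : ℝ => Complex.exp ((t * (2 * (1 + κ)) : ℝ) * x ^ 2 * I)), hG, hG, chiSqCharFun,
      Complex.ofReal_re, Complex.ofReal_im, ← Complex.ofReal_pow, Real.sq_sqrt (by positivity)]
    have hk : (1 + κ : ℂ) ≠ 0 := by exact_mod_cast hκ1.ne'
    have hD := one_sub_mul_I_ne_zero t
    rw [pow_one, ← hA]
    simp only [Complex.ofReal_zero, ne_eq, OfNat.ofNat_ne_zero, not_false_eq_true, zero_pow,
      zero_mul, Complex.exp_zero, mul_one]
    rw [mul_right_comm, ← sq]
    congr 2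
    push_cast
    field_simp
  rw [charFun_apply_real, integral_map (Measurable.aemeasurable (by fun_prop)) (by fun_prop),
    ricianLaw, integral_map (Measurable.aemeasurable (by fun_prop)) (by fun_prop)]
  have : ∀ x : Fin M → ℂ, Complex.exp (t * (2 * (1 + κ) * ‖WithLp.toLp 2 x‖ ^ 2 : ℝ) * I) =
      ∏ k, Complex.exp (t * (2 * (1 + κ) * ‖x k‖ ^ 2 : ℝ) * I) := by
    intro x
    rw [← Complex.exp_sum, ← Finset.sum_mul, ← Finset.mul_sum, EuclideanSpace.norm_sq_eq,
      Finset.mul_sum]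
    push_cast
    rfl
  simp_rw [this]
  have hp : SigmaFinite (complexNormal ((Real.sqrt (κ / (1 + κ)) : ℝ) : ℂ) (1 / (1 + κ))) := by
    unfold complexNormal
    exact MeasurableEquiv.sigmaFinite_map _
  rw [integral_fintype_prod_eq_pow (fun z : ℂ => Complex.exp (t * (2 * (1 + κ) * ‖z‖ ^ 2 : ℝ) * I)),
    hone, chiSqCharFun_pow, Fintype.card_fin, one_mul]
  congr 1
  ring

/-! ### Poisson mixtures of chi laws -/

lemma integrableOn_pow_mul_cexp_neg_mul_sq (n : ℕ) {b : ℂ} (hb : 0 < b.re) :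
    IntegrableOn (fun x : ℝ => (x : ℂ) ^ n * Complex.exp (-b * x ^ 2)) (Set.Ioi 0) := by
  have h := integrableOn_rpow_mul_exp_neg_mul_sq hb (s := n) (by
    have : (0 : ℝ) ≤ n := n.cast_nonneg
    linarith)
  refine Integrable.mono' h (by fun_prop) ?_
  filter_upwards [ae_restrict_mem measurableSet_Ioi] with x hx
  rw [norm_mul, Complex.norm_exp, norm_pow, Complex.norm_real, Real.norm_of_nonneg (le_of_lt hx),
    Real.rpow_natCast, ← Complex.ofReal_pow, Complex.re_mul_ofReal, Complex.neg_re]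

lemma integral_pow_mul_cexp_neg_mul_sq (j : ℕ) {b : ℂ} (hb : 0 < b.re) :
    ∫ x : ℝ in Set.Ioi 0, (x : ℂ) ^ (2 * j + 1) * Complex.exp (-b * x ^ 2) =
      j.factorial / (2 * b ^ (j + 1)) := by
  have hb0 : b ≠ 0 := by rintro rfl; simp at hb
  induction j with
  | zero => simpa using integral_mul_cexp_neg_mul_sq hb
  | succ j ih =>
    have hint := integrableOn_pow_mul_cexp_neg_mul_sq
    -- integration by parts: the derivative of `x ^ (2 j + 2) exp (-b x²)` integrates to zero
    have hd : ∀ x : ℝ, HasDerivAt (fun x : ℝ => (x : ℂ) ^ (2 * j + 2) * Complex.exp (-b * x ^ 2))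
        ((2 * j + 2) * ((x : ℂ) ^ (2 * j + 1) * Complex.exp (-b * x ^ 2)) -
          2 * b * ((x : ℂ) ^ (2 * (j + 1) + 1) * Complex.exp (-b * x ^ 2))) x := by
      intro x
      have h1 : HasDerivAt (fun z : ℂ => z ^ (2 * j + 2) * Complex.exp (-b * z ^ 2)) _ (x : ℂ) :=
        (hasDerivAt_pow (2 * j + 2) (x : ℂ)).mul
          (((hasDerivAt_pow 2 (x : ℂ)).const_mul (-b)).cexp)
      convert! h1.comp_ofReal using 1
      push_cast
      ring
    have hf' : IntegrableOn (fun x : ℝ =>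
        (2 * j + 2) * ((x : ℂ) ^ (2 * j + 1) * Complex.exp (-b * x ^ 2)) -
          2 * b * ((x : ℂ) ^ (2 * (j + 1) + 1) * Complex.exp (-b * x ^ 2))) (Set.Ioi 0) :=
      ((hint (2 * j + 1) hb).const_mul _).sub ((hint (2 * (j + 1) + 1) hb).const_mul _)
    have h0 := integral_Ioi_of_hasDerivAt_of_tendsto' (fun x _ => hd x) hf'
      (tendsto_zero_of_hasDerivAt_of_integrableOn_Ioi (fun x _ => hd x) hf'
        (hint (2 * j + 2) hb))
    rw [integral_sub ((hint (2 * j + 1) hb).const_mul _)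
      ((hint (2 * (j + 1) + 1) hb).const_mul _), integral_const_mul, integral_const_mul, ih] at h0
    have h1 : 2 * b * ∫ x : ℝ in Set.Ioi 0,
        (x : ℂ) ^ (2 * (j + 1) + 1) * Complex.exp (-b * x ^ 2) =
        (2 * j + 2) * (j.factorial / (2 * b ^ (j + 1))) := by
      simp only [Complex.ofReal_zero] at h0
      linear_combination (norm := skip) -h0
      simp
    refine mul_left_cancel₀ (mul_ne_zero two_ne_zero hb0) (h1.trans ?_)
    rw [Nat.factorial_succ]
    push_cast
    field_simp
    ring

/-- The `k`-th term in the expansion of the density of the non-central chi law with `2 (n + 1)`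
degrees of freedom as a Poisson mixture: the Poisson weight of `k` with mean `ψ / 2`, times the
density of the central chi law with `2 (n + 1 + k)` degrees of freedom. -/
noncomputable def chiTerm (n : ℕ) (ψ : ℝ) (k : ℕ) (x : ℝ) : ℝ :=
  Real.exp (-ψ / 2) * (ψ / 2) ^ k / k.factorial *
    (x ^ (2 * (n + k) + 1) * Real.exp (-x ^ 2 / 2) / (2 ^ (n + k) * (n + k).factorial))

lemma chiTerm_nonneg (n : ℕ) {ψ : ℝ} (hψ : 0 ≤ ψ) (k : ℕ) {x : ℝ} (hx : 0 ≤ x) :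
    0 ≤ chiTerm n ψ k x := by
  unfold chiTerm; positivity

@[fun_prop]
lemma continuous_chiTerm (n : ℕ) (ψ : ℝ) (k : ℕ) : Continuous (chiTerm n ψ k) := by
  unfold chiTerm; fun_prop

lemma chiTerm_mul_cexp (n : ℕ) (ψ : ℝ) (k : ℕ) (t x : ℝ) :
    (chiTerm n ψ k x : ℂ) * Complex.exp (t * (x ^ 2 : ℝ) * I) =
      (Real.exp (-ψ / 2) * (ψ / 2) ^ k / k.factorial / (2 ^ (n + k) * (n + k).factorial) : ℝ) *
        ((x : ℂ) ^ (2 * (n + k) + 1) * Complex.exp (-((1 - 2 * t * I) / 2) * x ^ 2)) := by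
  have : Complex.exp (-((1 - 2 * t * I) / 2) * x ^ 2) =
      Complex.exp (-x ^ 2 / 2) * Complex.exp (t * (x ^ 2 : ℝ) * I) := by
    rw [← Complex.exp_add]; congr 1; push_cast; ring
  rw [this, chiTerm]
  push_cast
  ring

lemma re_one_sub_mul_I_div_two (t : ℝ) : 0 < ((1 - 2 * t * I : ℂ) / 2).re := by
  simp

lemma integral_chiTerm_mul_cexp (n : ℕ) (ψ : ℝ) (k : ℕ) (t : ℝ) :
    ∫ x in Set.Ioi 0, (chiTerm n ψ k x : ℂ) * Complex.exp (t * (x ^ 2 : ℝ) * I) =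
      Complex.exp (-ψ / 2) * (ψ / 2) ^ k / k.factorial * (1 - 2 * t * I)⁻¹ ^ (n + k + 1) := by
  simp_rw [chiTerm_mul_cexp]
  rw [integral_const_mul, integral_pow_mul_cexp_neg_mul_sq _ (re_one_sub_mul_I_div_two t)]
  have := one_sub_mul_I_ne_zero t
  have h3 : ((n + k).factorial : ℂ) ≠ 0 := by exact_mod_cast Nat.factorial_ne_zero _
  push_cast
  generalize (1 - 2 * t * I : ℂ) = d at this
  rw [div_pow d, inv_pow, pow_succ 2]
  field_simp

lemma integrableOn_chiTerm (n : ℕ) (ψ : ℝ) (k : ℕ) :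
    IntegrableOn (chiTerm n ψ k) (Set.Ioi 0) := by
  have h := (integrableOn_pow_mul_cexp_neg_mul_sq (2 * (n + k) + 1)
    (re_one_sub_mul_I_div_two 0)).const_mul
      ((Real.exp (-ψ / 2) * (ψ / 2) ^ k / k.factorial / (2 ^ (n + k) * (n + k).factorial) : ℝ) : ℂ)
  simp_rw [← chiTerm_mul_cexp] at h
  refine Integrable.congr h.re (.of_forall fun x => ?_)
  simp

lemma integral_chiTerm (n : ℕ) (ψ : ℝ) (k : ℕ) :
    ∫ x in Set.Ioi 0, chiTerm n ψ k x = Real.exp (-ψ / 2) * (ψ / 2) ^ k / k.factorial := by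
  have h := integral_chiTerm_mul_cexp n ψ k 0
  simp only [Complex.ofReal_zero, zero_mul, Complex.exp_zero, mul_one, mul_zero, sub_zero, inv_one,
    one_pow, integral_complex_ofReal] at h
  exact_mod_cast h

lemma hasSum_poisson_weights (ψ : ℝ) :
    HasSum (fun k : ℕ => Real.exp (-ψ / 2) * (ψ / 2) ^ k / k.factorial) 1 := by
  have h := (NormedSpace.expSeries_div_hasSum_exp (𝔸 := ℝ) (ψ / 2)).mul_left (Real.exp (-ψ / 2))
  rw [← Real.exp_eq_exp_ℝ, ← Real.exp_add] at h
  convert! h using 1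
  · ext k; ring
  · rw [eq_comm, Real.exp_eq_one_iff]; ring

/-- The non-central chi law with `2 (n + 1)` degrees of freedom (the law of the square root of a
non-central chi-squared variable of non-centrality `ψ`), as a Poisson mixture of central ones. -/
noncomputable def chiMixture (n : ℕ) (ψ : ℝ) : Measure ℝ :=
  Measure.sum fun k => (volume.restrict (Set.Ioi 0)).withDensity
    fun x => ENNReal.ofReal (chiTerm n ψ k x)

lemma chiMixture_Ioi_of_nonneg (n : ℕ) {ψ : ℝ} (hψ : 0 ≤ ψ) {b : ℝ} (hb : 0 ≤ b) :
    chiMixture n ψ (Set.Ioi b) = ENNReal.ofReal (∑' k, ∫ x in Set.Ioi b, chiTerm n ψ k x) ∧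
      Summable fun k => ∫ x in Set.Ioi b, chiTerm n ψ k x := by
  have hsub : Set.Ioi b ⊆ Set.Ioi 0 := Set.Ioi_subset_Ioi hb
  have hnn : ∀ k, 0 ≤ ∫ x in Set.Ioi b, chiTerm n ψ k x := fun k =>
    setIntegral_nonneg measurableSet_Ioi fun x hx => chiTerm_nonneg n hψ k (hb.trans (le_of_lt hx))
  have hs : Summable fun k => ∫ x in Set.Ioi b, chiTerm n ψ k x := by
    refine Summable.of_nonneg_of_le hnn (fun k => ?_) (hasSum_poisson_weights ψ).summable
    rw [← integral_chiTerm n ψ k]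
    refine setIntegral_mono_set (integrableOn_chiTerm n ψ k) ?_ hsub.eventuallyLE
    filter_upwards [ae_restrict_mem measurableSet_Ioi] with x hx
    exact chiTerm_nonneg n hψ k (le_of_lt hx)
  refine ⟨?_, hs⟩
  rw [chiMixture, Measure.sum_apply _ measurableSet_Ioi, ENNReal.ofReal_tsum_of_nonneg hnn hs]
  refine tsum_congr fun k => ?_
  rw [withDensity_apply _ measurableSet_Ioi, Measure.restrict_restrict measurableSet_Ioi,
    Set.inter_eq_left.2 hsub, ofReal_integral_eq_lintegral_ofReal
      ((integrableOn_chiTerm n ψ k).mono_set hsub)]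
  filter_upwards [ae_restrict_mem measurableSet_Ioi] with x hx
  exact chiTerm_nonneg n hψ k (hb.trans (le_of_lt hx))

lemma chiMixture_Iic_zero (n : ℕ) (ψ : ℝ) : chiMixture n ψ (Set.Iic 0) = 0 := by
  rw [chiMixture, Measure.sum_apply _ measurableSet_Iic]
  refine ENNReal.tsum_eq_zero.2 fun k => ?_
  rw [withDensity_apply _ measurableSet_Iic, Measure.restrict_restrict measurableSet_Iic,
    Set.Iic_inter_Ioi, Set.Ioc_self, Measure.restrict_empty, lintegral_zero_measure]

lemma isProbabilityMeasure_chiMixture (n : ℕ) {ψ : ℝ} (hψ : 0 ≤ ψ) :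
    IsProbabilityMeasure (chiMixture n ψ) := by
  refine ⟨?_⟩
  rw [← Set.Iic_union_Ioi (a := (0 : ℝ)),
    measure_union (Set.Iic_disjoint_Ioi le_rfl) measurableSet_Ioi,
    chiMixture_Iic_zero, (chiMixture_Ioi_of_nonneg n hψ le_rfl).1]
  rw [tsum_congr (integral_chiTerm n ψ), (hasSum_poisson_weights ψ).tsum_eq]
  simp

lemma chiMixture_singleton (n : ℕ) (ψ b : ℝ) : chiMixture n ψ {b} = 0 := by
  rw [chiMixture, Measure.sum_apply _ (measurableSet_singleton b)]
  refine ENNReal.tsum_eq_zero.2 fun k => ?_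
  exact ((withDensity_absolutelyContinuous _ _).trans
    Measure.restrict_le_self.absolutelyContinuous) (by simp)

lemma charFun_sq_chiMixture (n : ℕ) {ψ : ℝ} (hψ : 0 ≤ ψ) (t : ℝ) :
    charFun ((chiMixture n ψ).map fun x => x ^ 2) t = chiSqCharFun (n + 1) ψ t := by
  have := isProbabilityMeasure_chiMixture n hψ
  have hint : Integrable (fun x : ℝ => Complex.exp (t * (x ^ 2 : ℝ) * I)) (chiMixture n ψ) := by
    refine Integrable.of_bound (by fun_prop) 1 (.of_forall fun x => ?_)
    rw [← Complex.ofReal_mul, Complex.norm_exp_ofReal_mul_I]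
  rw [charFun_apply_real, integral_map (Measurable.aemeasurable (by fun_prop)) (by fun_prop)]
  have hsum := hasSum_integral_measure hint
  have hterm : ∀ k, ∫ x : ℝ, Complex.exp (t * (x ^ 2 : ℝ) * I)
      ∂((volume.restrict (Set.Ioi 0)).withDensity fun x => ENNReal.ofReal (chiTerm n ψ k x)) =
      Complex.exp (-ψ / 2) * (ψ / 2) ^ k / k.factorial * (1 - 2 * t * I)⁻¹ ^ (n + k + 1) := by
    intro k
    rw [← integral_chiTerm_mul_cexp, integral_withDensity_eq_integral_toReal_smul (by fun_prop)
      (.of_forall fun _ => ENNReal.ofReal_lt_top)]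
    refine setIntegral_congr_fun measurableSet_Ioi fun x hx => ?_
    simp only [ENNReal.toReal_ofReal (chiTerm_nonneg n hψ k (le_of_lt hx)), Complex.real_smul]
  simp_rw [hterm] at hsum
  refine hsum.unique ?_
  have hD := one_sub_mul_I_ne_zero t
  have h := (NormedSpace.expSeries_div_hasSum_exp (𝔸 := ℂ)
    (ψ / 2 * (1 - 2 * t * I)⁻¹)).mul_left
      (Complex.exp (-ψ / 2) * (1 - 2 * t * I)⁻¹ ^ (n + 1))
  rw [← Complex.exp_eq_exp_ℂ] at h
  convert! h using 1
  · ext k; rw [mul_pow]; ring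
  · rw [chiSqCharFun, mul_right_comm (Complex.exp _), ← Complex.exp_add,
      mul_comm (_ ^ (n + 1))]
    congr 2
    generalize hd : (1 - 2 * t * I : ℂ) = d at hD ⊢
    have ht : (t : ℂ) * I = (1 - d) / 2 := by rw [← hd]; ring
    rw [ht]
    field_simp
    ring

/-! ### The Marcum function as a tail probability -/

/-- The term-by-term expansion of the Bessel function turns the Marcum integrand into the density of
the Poisson mixture; for `a = 0` only the term `k = 0` survives. -/
lemma marcumQ_eq_integral_tsum (n : ℕ) {a : ℝ} (b : ℝ) :
    marcumQ (n + 1) a b = ∫ x in Set.Ioi b, ∑' k, chiTerm n (a ^ 2) k x := by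
  unfold marcumQ
  split_ifs with ha
  · congr 1 with x
    rw [tsum_eq_single 0 (fun k hk => by simp [chiTerm, ha, hk])]
    simp [chiTerm, ha, mul_add]
  · congr 1 with x
    rw [besselI, ← tsum_mul_left]
    refine tsum_congr fun k => ?_
    have hexp : Real.exp (-(x ^ 2 + a ^ 2) / 2) =
        Real.exp (-a ^ 2 / 2) * Real.exp (-x ^ 2 / 2) := by
      rw [← Real.exp_add]; congr 1; ring
    rw [chiTerm, hexp, Nat.add_sub_cancel, add_comm k n]
    have h1 : (a * x / 2) ^ (2 * k + n) =
        a ^ n * (a ^ 2) ^ k * x ^ (2 * k + n) / 2 ^ (2 * k + n) := by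
      rw [div_pow, mul_pow, pow_add a, pow_mul a]; ring
    have h2 : x ^ (2 * (n + k) + 1) = x ^ n * x * x ^ (2 * k + n) := by ring
    have h3 : (2 : ℝ) ^ (2 * k + n) = 2 ^ k * 2 ^ (n + k) := by ring
    rw [h1, h2, h3, div_pow, div_pow]
    field_simp

lemma sq_chiMixture_Ici (n : ℕ) {a b : ℝ} (hb : 0 ≤ b) :
    ((chiMixture n (a ^ 2)).map fun x => x ^ 2).real (Set.Ici (b ^ 2)) = marcumQ (n + 1) a b := by
  have hψ : 0 ≤ a ^ 2 := sq_nonneg a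
  have hIoi := chiMixture_Ioi_of_nonneg n hψ hb
  have hsub : Set.Ioi b ⊆ Set.Ioi 0 := Set.Ioi_subset_Ioi hb
  have hae : (fun x : ℝ => x ^ 2) ⁻¹' Set.Ici (b ^ 2) =ᵐ[chiMixture n (a ^ 2)] Set.Ioi b := by
    have h0 : ∀ᵐ x ∂chiMixture n (a ^ 2), x ∉ Set.Iic (0 : ℝ) :=
      measure_eq_zero_iff_ae_notMem.1 (chiMixture_Iic_zero n _)
    have h1 : ∀ᵐ x ∂chiMixture n (a ^ 2), x ∉ ({b} : Set ℝ) :=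
      measure_eq_zero_iff_ae_notMem.1 (chiMixture_singleton n _ b)
    filter_upwards [h0, h1] with x hx0 hx1
    simp only [Set.mem_Iic, not_le, Set.mem_singleton_iff] at hx0 hx1
    change (b ^ 2 ≤ x ^ 2) = (b < x)
    rw [eq_iff_iff, sq_le_sq₀ hb hx0.le]
    exact ⟨fun h => lt_of_le_of_ne h (Ne.symm hx1), le_of_lt⟩
  rw [measureReal_def, Measure.map_apply (by fun_prop) measurableSet_Ici, measure_congr hae,
    hIoi.1, ENNReal.toReal_ofReal, marcumQ_eq_integral_tsum]
  · refine (hasSum_integral_of_summable_integral_norm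
      (fun k => (integrableOn_chiTerm n _ k).mono_set hsub) ?_).tsum_eq
    refine hIoi.2.congr fun k => setIntegral_congr_fun measurableSet_Ioi fun x hx => ?_
    exact (Real.norm_of_nonneg <| chiTerm_nonneg n hψ k (hb.trans (le_of_lt hx))).symm
  · exact tsum_nonneg fun k => setIntegral_nonneg measurableSet_Ioi fun x hx =>
      chiTerm_nonneg n hψ k (hb.trans (le_of_lt hx))

/-! ### Optimality of maximum ratio transmission -/

lemma norm_sum_mul_le {M : ℕ} (h w : EuclideanSpace ℂ (Fin M)) :
    ‖∑ k, h k * w k‖ ^ 2 ≤ ‖h‖ ^ 2 * ‖w‖ ^ 2 := by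
  rw [EuclideanSpace.norm_sq_eq, EuclideanSpace.norm_sq_eq]
  refine le_trans ?_ (Finset.sum_mul_sq_le_sq_mul_sq Finset.univ (fun k => ‖h k‖) fun k => ‖w k‖)
  gcongr
  exact (norm_sum_le _ _).trans_eq (Finset.sum_congr rfl fun k _ => norm_mul _ _)

lemma isPrecoder_mrt {M : ℕ} {Ω : Type*} [MeasurableSpace Ω] {h : ℕ → Ω → EuclideanSpace ℂ (Fin M)}
    (hh : ∀ τ, Measurable (h τ)) : IsPrecoder fun τ ω => mrt (h τ ω) := by
  refine ⟨fun τ j => ?_, fun τ ω => ?_⟩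
  · unfold mrt
    have := hh τ
    refine (WithLp.measurable_toLp 2 _).comp (measurable_pi_lambda _ fun k => ?_)
    refine Measurable.div ?_ (by fun_prop)
    exact continuous_star.measurable.comp (by fun_prop)
  · have hj : ∀ j, ‖mrt (h τ ω) j‖ ^ 2 ≤ 1 / M := by
      intro j
      rw [EuclideanSpace.norm_sq_eq]
      simp only [mrt, norm_div, norm_star, Complex.norm_real, div_pow, sq_abs, Real.norm_eq_abs,
        mul_pow, Real.sq_sqrt (Nat.cast_nonneg M)]
      rw [← Finset.sum_div, ← EuclideanSpace.norm_sq_eq, mul_comm, ← div_div]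
      gcongr
      exact div_self_le_one _
    refine (Finset.sum_le_sum fun j _ => hj j).trans ?_
    simpa using mul_inv_le_one

lemma sum_mul_mrt {M : ℕ} (h : EuclideanSpace ℂ (Fin M)) (j : Fin M) :
    ‖∑ k, h k * mrt h j k‖ ^ 2 = ‖h‖ ^ 2 / M := by
  have h1 : ∑ k, h k * mrt h j k = ((‖h‖ ^ 2 / (Real.sqrt M * ‖h‖) : ℝ) : ℂ) := by
    simp only [mrt, ← mul_div_assoc, ← Finset.sum_div]
    rw [EuclideanSpace.norm_sq_eq]
    push_cast
    congr 1
    refine Finset.sum_congr rfl fun k _ => ?_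
    exact Complex.mul_conj' (h k)
  rw [h1, Complex.norm_real, Real.norm_eq_abs, sq_abs]
  -- where `h = 0`, both sides are zero
  rcases eq_or_ne ‖h‖ 0 with h0 | h0
  · simp [h0]
  · rw [div_pow, mul_pow, Real.sq_sqrt (Nat.cast_nonneg M)]
    field_simp

namespace Network

variable {ι Ω : Type*} [MeasurableSpace Ω] (S : Network ι)

lemma rfPower_mrt (i : ι) (h : EuclideanSpace ℂ (Fin S.Mt)) :
    S.rfPower i h (mrt h) = S.P * S.β i * ‖h‖ ^ 2 := by
  have hM : (S.Mt : ℝ) ≠ 0 := by exact_mod_cast S.Mt_pos.ne'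
  rw [rfPower]
  simp_rw [sum_mul_mrt]
  simp only [Finset.sum_const, Finset.card_univ, Fintype.card_fin, nsmul_eq_mul]
  field_simp

/-- By the Cauchy–Schwarz inequality, no precoder delivers more power to a node than
maximum ratio transmission towards it. -/
lemma rfPower_le_rfPower_mrt (i : ι) (h : EuclideanSpace ℂ (Fin S.Mt))
    {w : Fin S.Mt → EuclideanSpace ℂ (Fin S.Mt)} (hw : ∑ j, ‖w j‖ ^ 2 ≤ 1) :
    S.rfPower i h w ≤ S.rfPower i h (mrt h) := by
  have := S.P_pos
  have := S.β_pos i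
  rw [rfPower_mrt, rfPower]
  gcongr
  calc ∑ j, ‖∑ k, h k * w j k‖ ^ 2 ≤ ∑ j, ‖h‖ ^ 2 * ‖w j‖ ^ 2 :=
        Finset.sum_le_sum fun j _ => norm_sum_mul_le h (w j)
    _ = ‖h‖ ^ 2 * ∑ j, ‖w j‖ ^ 2 := by rw [Finset.mul_sum]
    _ ≤ ‖h‖ ^ 2 := mul_le_of_le_one_right (sq_nonneg _) hw

lemma outage_mrt_le (μ : Measure Ω) [IsFiniteMeasure μ]
    (h : ι → ℕ → Ω → EuclideanSpace ℂ (Fin S.Mt)) (U : ι → Ω → ℝ)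
    {w : ℕ → Ω → Fin S.Mt → EuclideanSpace ℂ (Fin S.Mt)} (hw : IsPrecoder w) (i : ι) :
    S.outage h U μ (fun τ ω => mrt (h i τ ω)) i ≤ S.outage h U μ w i := by
  refine measureReal_mono fun ω hω => Set.mem_ofPred.2 (lt_of_le_of_lt ?_ (Set.mem_ofPred.1 hω))
  have := S.η_pos
  have := S.Tc_pos
  unfold harvested
  gcongr with τ
  exact S.rfPower_le_rfPower_mrt i _ (hw.power_le_one τ ω)

end Network

/-! ### The slotted inter-arrival count -/

lemma measurable_slotted : Measurable slotted :=
  Nat.measurable_floor.add_const 1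

lemma measureReal_expMeasure_Ici {l : ℝ} (hl : 0 < l) {x : ℝ} (hx : 0 ≤ x) :
    (expMeasure l).real (Set.Ici x) = Real.exp (-(l * x)) := by
  have := isProbabilityMeasure_expMeasure hl
  have hac : expMeasure l {x} = 0 := withDensity_absolutelyContinuous _ _ (by simp)
  have hIoi : (expMeasure l).real (Set.Ioi x) = Real.exp (-(l * x)) := by
    rw [← Set.compl_Iic, probReal_compl_eq_one_sub measurableSet_Iic, ← cdf_eq_real,
      cdf_expMeasure_eq hl, if_pos hx]
    ring
  rw [← hIoi]
  refine measureReal_congr ?_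
  have h1 : ∀ᵐ y ∂expMeasure l, y ∉ ({x} : Set ℝ) := measure_eq_zero_iff_ae_notMem.1 hac
  filter_upwards [h1] with y hy
  change (x ≤ y) = (x < y)
  exact propext ⟨fun h => lt_of_le_of_ne h (Ne.symm hy), le_of_lt⟩

lemma lt_slotted_iff (u : ℝ) {n : ℕ} (hn : 1 ≤ n) : n < slotted u ↔ (n : ℝ) ≤ u := by
  rw [slotted, Nat.lt_succ_iff, Nat.le_floor_iff' (by omega)]

section Slots

variable {Ω : Type*} [MeasurableSpace Ω] {μ : Measure Ω} [IsProbabilityMeasure μ] {U : Ω → ℝ}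
  {l : ℝ}

lemma measureReal_lt_slotted (hl : 0 < l) (hU : Measurable U) (hlaw : μ.map U = expMeasure l)
    (n : ℕ) : μ.real {ω | n < slotted (U ω)} = Real.exp (-l * n) := by
  rcases Nat.eq_zero_or_pos n with rfl | hn
  · simp [slotted]
  · have : {ω | n < slotted (U ω)} = U ⁻¹' Set.Ici (n : ℝ) := by
      ext ω; exact lt_slotted_iff _ hn
    rw [this, ← map_measureReal_apply hU measurableSet_Ici, hlaw,
      measureReal_expMeasure_Ici hl n.cast_nonneg, neg_mul]

lemma measureReal_slotted_eq (hl : 0 < l) (hU : Measurable U) (hlaw : μ.map U = expMeasure l)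
    {v : ℕ} (hv : 1 ≤ v) :
    μ.real {ω | slotted (U ω) = v} = (Real.exp l - 1) * Real.exp (-l * v) := by
  obtain ⟨n, rfl⟩ : ∃ n, v = n + 1 := ⟨v - 1, by omega⟩
  have : {ω | slotted (U ω) = n + 1} =
      {ω | n < slotted (U ω)} \ {ω | n + 1 < slotted (U ω)} := by
    ext ω; simp only [Set.mem_ofPred_eq, Set.mem_sdiff]; omega
  have hsub : {ω | n + 1 < slotted (U ω)} ⊆ {ω | n < slotted (U ω)} := by
    intro ω; simp only [Set.mem_ofPred_eq]; omega
  have hms : MeasurableSet {ω | n + 1 < slotted (U ω)} :=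
    measurableSet_lt measurable_const (measurable_slotted.comp hU)
  rw [this, measureReal_sdiff hsub hms,
    measureReal_lt_slotted hl hU hlaw, measureReal_lt_slotted hl hU hlaw, sub_mul,
    ← Real.exp_add]
  push_cast
  ring_nf

end Slots

/-- The failure probability at a random time `V`, split according to whether `V ≤ n`. -/
lemma measureReal_lt_eq_one_sub_sum {Ω : Type*} [MeasurableSpace Ω] {μ : Measure Ω}
    [IsProbabilityMeasure μ] {V : Ω → ℕ} (hV : Measurable V) (hV1 : ∀ ω, 1 ≤ V ω)
    {X : ℕ → Ω → ℝ} (hX : ∀ v, Measurable (X v)) (e : ℕ → ℝ) (n : ℕ) :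
    μ.real {ω | X (V ω) ω < e (V ω)} =
      1 - ∑ v ∈ Finset.Icc 1 n, μ.real {ω | V ω = v ∧ e v ≤ X v ω} -
        μ.real ({ω | n < V ω} ∩ {ω | e (V ω) ≤ X (V ω) ω}) := by
  have hXV : Measurable fun ω => X (V ω) ω :=
    (measurable_from_prod_countable_left (f := fun p : Ω × ℕ => X p.2 p.1) hX).comp
      (measurable_id.prodMk hV)
  have hG : MeasurableSet {ω | e (V ω) ≤ X (V ω) ω} :=
    measurableSet_le ((measurable_from_nat (f := e)).comp hV) hXV
  have hA : MeasurableSet {ω | n < V ω} := measurableSet_lt measurable_const hV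
  have hout : {ω | X (V ω) ω < e (V ω)} = {ω | e (V ω) ≤ X (V ω) ω}ᶜ := by
    ext ω; simp
  have hfin : {ω | e (V ω) ≤ X (V ω) ω} \ {ω | n < V ω} =
      ⋃ v ∈ Finset.Icc 1 n, {ω | V ω = v ∧ e v ≤ X v ω} := by
    ext ω
    simp only [Set.mem_sdiff, Set.mem_ofPred_eq, Set.mem_iUnion, Finset.mem_Icc, exists_prop,
      not_lt]
    constructor
    · rintro ⟨h1, h2⟩
      exact ⟨V ω, ⟨hV1 ω, h2⟩, rfl, h1⟩
    · rintro ⟨v, ⟨-, h2⟩, rfl, h1⟩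
      exact ⟨h1, h2⟩
  rw [hout, probReal_compl_eq_one_sub hG, ← measureReal_inter_add_sdiff (s := {ω | _ ≤ _}) hA,
    hfin, measureReal_biUnion_finset, Set.inter_comm]
  · ring
  · intro v _ v' _ hne
    refine Set.disjoint_left.2 fun ω h1 h2 => hne ?_
    exact (Set.mem_ofPred.1 h1).1.symm.trans (Set.mem_ofPred.1 h2).1
  · intro v _
    exact (hV (measurableSet_singleton v)).inter (measurableSet_le measurable_const (hX v))

/-! ### The law of the accumulated channel energy -/

lemma isProbabilityMeasure_noncentralChiSq (n : ℕ) (ψ : ℝ) :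
    IsProbabilityMeasure (noncentralChiSq n ψ) :=
  Measure.isProbabilityMeasure_map (Measurable.aemeasurable (by fun_prop))

lemma isProbabilityMeasure_ricianLaw (M : ℕ) (κ : ℝ) : IsProbabilityMeasure (ricianLaw M κ) := by
  have : IsProbabilityMeasure (complexNormal ((Real.sqrt (κ / (1 + κ)) : ℝ) : ℂ) (1 / (1 + κ))) :=
    Measure.isProbabilityMeasure_map Complex.measurableEquivRealProd.symm.measurable.aemeasurable
  exact Measure.isProbabilityMeasure_map (by fun_prop)

lemma map_sq_norm_ricianLaw {M : ℕ} (hM : 0 < M) {κ : ℝ} (hκ : 0 ≤ κ) :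
    (ricianLaw M κ).map (fun h => 2 * (1 + κ) * ‖h‖ ^ 2) =
      noncentralChiSq (2 * M) (2 * M * κ) := by
  have := isProbabilityMeasure_ricianLaw M κ
  have := isProbabilityMeasure_noncentralChiSq (2 * M) (2 * M * κ)
  refine Measure.ext_of_charFun (funext fun t => ?_)
  rw [charFun_sq_norm_ricianLaw M hκ, charFun_noncentralChiSq M hM (by positivity)]

section Channel

variable {Ω : Type*} [MeasurableSpace Ω] {μ : Measure Ω} [IsProbabilityMeasure μ] {M : ℕ} {κ : ℝ}
  {H : ℕ → Ω → EuclideanSpace ℂ (Fin M)}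

/-- The channel energy accumulated in `v` coherence intervals is non-central chi-squared with
`2 M v` degrees of freedom, in the form of its Poisson mixture. -/
lemma map_sum_sq_norm (hM : 0 < M) (hκ : 0 ≤ κ) (hH : ∀ τ, Measurable (H τ))
    (hlaw : ∀ τ, μ.map (H τ) = ricianLaw M κ) (hind : iIndepFun H μ) {v : ℕ} (hv : 1 ≤ v) :
    μ.map (fun ω => ∑ τ ∈ Finset.range v, 2 * (1 + κ) * ‖H τ ω‖ ^ 2) =
      (chiMixture (M * v - 1) (2 * M * κ * v)).map fun x => x ^ 2 := by
  have hψ : 0 ≤ 2 * M * κ * v := by positivity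
  have := isProbabilityMeasure_chiMixture (M * v - 1) hψ
  have hX : ∀ τ, Measurable fun ω => 2 * (1 + κ) * ‖H τ ω‖ ^ 2 := fun τ => by
    have := hH τ
    fun_prop
  have hXind : iIndepFun (fun τ ω => 2 * (1 + κ) * ‖H τ ω‖ ^ 2) μ :=
    hind.comp (fun _ h => 2 * (1 + κ) * ‖h‖ ^ 2) fun _ => by fun_prop
  refine Measure.ext_of_charFun (funext fun t => ?_)
  rw [(hXind.restrict (Finset.range v)).charFun_map_fun_finsetSum_eq_prod
    (fun τ _ => (hX τ).aemeasurable), Finset.prod_apply, charFun_sq_chiMixture _ hψ,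
    Nat.sub_add_cancel (Nat.mul_pos hM hv), ← chiSqCharFun_pow]
  rw [Finset.prod_congr rfl fun τ _ => ?_, Finset.prod_const, Finset.card_range]
  rw [← charFun_sq_norm_ricianLaw M hκ, ← hlaw τ, Measure.map_map (by fun_prop) (hH τ)]
  rfl

lemma measureReal_le_sum_sq_norm (hM : 0 < M) (hκ : 0 ≤ κ) (hH : ∀ τ, Measurable (H τ))
    (hlaw : ∀ τ, μ.map (H τ) = ricianLaw M κ) (hind : iIndepFun H μ) {v : ℕ} (hv : 1 ≤ v)
    {b : ℝ} (hb : 0 ≤ b) :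
    μ.real {ω | b ^ 2 ≤ ∑ τ ∈ Finset.range v, 2 * (1 + κ) * ‖H τ ω‖ ^ 2} =
      marcumQ (M * v) (Real.sqrt (2 * M * κ * v)) b := by
  have hX : Measurable fun ω => ∑ τ ∈ Finset.range v, 2 * (1 + κ) * ‖H τ ω‖ ^ 2 := by
    fun_prop
  have h := sq_chiMixture_Ici (M * v - 1) (a := Real.sqrt (2 * M * κ * v)) hb
  rw [Real.sq_sqrt (by positivity), ← map_sum_sq_norm hM hκ hH hlaw hind hv,
    map_measureReal_apply hX measurableSet_Ici, Nat.sub_add_cancel (Nat.mul_pos hM hv)] at h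
  exact h

end Channel

/-! ### The outage probability and its truncated expression -/

namespace Network

variable {ι Ω : Type*} [MeasurableSpace Ω] (S : Network ι)

@[fun_prop]
lemma measurable_rfPower_mrt (i : ι) :
    Measurable fun h : EuclideanSpace ℂ (Fin S.Mt) => S.rfPower i h (mrt h) := by
  simp_rw [rfPower_mrt]
  fun_prop

lemma requiredEnergy_eq (v : ℕ) :
    S.requiredEnergy v = v * (S.ξd + S.pc * S.Tc) + S.ξu + S.p * S.t := by
  rw [requiredEnergy]; ring

lemma requiredEnergy_nonneg (v : ℕ) : 0 ≤ S.requiredEnergy v := by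
  have := S.ξd_nonneg
  have := S.ξu_nonneg
  have := S.pc_nonneg
  have := S.p_nonneg
  have := S.Tc_pos
  have := S.t_pos
  unfold requiredEnergy
  positivity

lemma map_rfPower_mrt {μ : Measure Ω} (i : ι) {H : Ω → EuclideanSpace ℂ (Fin S.Mt)}
    (hH : Measurable H) (hlaw : μ.map H = ricianLaw S.Mt S.κ) :
    μ.map (fun ω => S.rfPower i (H ω) (mrt (H ω))) =
      (noncentralChiSq (2 * S.Mt) (2 * S.Mt * S.κ)).map
        fun x => S.P * S.β i / (2 * (1 + S.κ)) * x := by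
  have hκ := S.κ_nonneg
  have hκ1 : 1 + S.κ ≠ 0 := by positivity
  rw [← map_sq_norm_ricianLaw S.Mt_pos hκ, ← hlaw, Measure.map_map (by fun_prop) hH,
    Measure.map_map (by fun_prop) (by fun_prop)]
  congr 1
  ext ω
  simp only [Function.comp_apply, rfPower_mrt]
  field_simp

/-- The event that the node `i` meets its energy requirement over `v` intervals under MRT towards
it, in terms of the accumulated channel energy. -/
lemma requiredEnergy_le_harvested_mrt_iff (i : ι) (H : ℕ → EuclideanSpace ℂ (Fin S.Mt)) (v : ℕ) :
    S.requiredEnergy v ≤ S.harvested i H (fun τ => mrt (H τ)) v ↔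
      (Real.sqrt (2 * (1 + S.κ) / (S.η * S.Tc * S.P * S.β i)) *
        Real.sqrt (v * (S.ξd + S.pc * S.Tc) + S.ξu + S.p * S.t)) ^ 2 ≤
      ∑ τ ∈ Finset.range v, 2 * (1 + S.κ) * ‖H τ‖ ^ 2 := by
  have hη := S.η_pos
  have hTc := S.Tc_pos
  have hP := S.P_pos
  have hβ := S.β_pos i
  have hκ := S.κ_nonneg
  have hE := S.requiredEnergy_nonneg v
  have hc : 0 < S.η * S.Tc * S.P * S.β i := by positivity
  rw [← requiredEnergy_eq, mul_pow, Real.sq_sqrt (by positivity), Real.sq_sqrt hE, harvested]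
  simp_rw [rfPower_mrt]
  rw [← Finset.mul_sum, ← Finset.mul_sum, div_mul_eq_mul_div, div_le_iff₀ hc]
  have h2 : 0 < 2 * (1 + S.κ) := by positivity
  rw [← mul_le_mul_iff_right₀ h2 (b := S.requiredEnergy v)]
  refine iff_of_eq (congrArg _ ?_)
  ring

section Model

variable {S} {h : ι → ℕ → Ω → EuclideanSpace ℂ (Fin S.Mt)} {U : ι → Ω → ℝ} {μ : Measure Ω}
  [IsProbabilityMeasure μ]

/-- Each summand of the truncated bound is the probability that `v` intervals elapse between two
uplink transmissions and the energy harvested in them suffices. -/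
lemma IsPoissonModel.measureReal_slotted_eq_and_le (hm : S.IsPoissonModel h U μ) (i : ι) {v : ℕ}
    (hv : 1 ≤ v) :
    μ.real {ω | slotted (U i ω) = v ∧ S.requiredEnergy v ≤
        S.harvested i (fun τ => h i τ ω) (fun τ => mrt (h i τ ω)) v} =
      (Real.exp S.lam - 1) * Real.exp (-S.lam * v) *
        marcumQ (S.Mt * v) (Real.sqrt (2 * S.Mt * S.κ * v))
          (Real.sqrt (2 * (1 + S.κ) / (S.η * S.Tc * S.P * S.β i)) *
            Real.sqrt (v * (S.ξd + S.pc * S.Tc) + S.ξu + S.p * S.t)) := by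
  rw [← measureReal_slotted_eq S.lam_pos (hm.measurable_arrival i) (hm.law_arrival i) hv,
    ← measureReal_le_sum_sq_norm S.Mt_pos S.κ_nonneg (hm.measurable_channel i) (hm.law_channel i)
      (hm.indep_channel i) hv (by positivity)]
  simp_rw [requiredEnergy_le_harvested_mrt_iff]
  set b := Real.sqrt (2 * (1 + S.κ) / (S.η * S.Tc * S.P * S.β i)) *
    Real.sqrt (v * (S.ξd + S.pc * S.Tc) + S.ξu + S.p * S.t)
  have hA : MeasurableSet (slotted ⁻¹' {v}) := measurable_slotted (measurableSet_singleton v)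
  have hB : MeasurableSet {H : ℕ → EuclideanSpace ℂ (Fin S.Mt) |
      b ^ 2 ≤ ∑ τ ∈ Finset.range v, 2 * (1 + S.κ) * ‖H τ‖ ^ 2} :=
    measurableSet_le measurable_const (by fun_prop)
  have := (hm.indep_arrival i).measure_inter_preimage_eq_mul _ _ hA hB
  rw [measureReal_def, measureReal_def, measureReal_def, ← ENNReal.toReal_mul]
  exact congrArg ENNReal.toReal this

/-- The truncation error `B(n) - O⋆` is the probability that the node succeeds after more than `n`
intervals. -/
lemma IsPoissonModel.truncatedBound_eq (hm : S.IsPoissonModel h U μ) (i : ι) (n : ℕ) :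
    S.truncatedBound i n = S.outage h U μ (fun τ ω => mrt (h i τ ω)) i +
      μ.real ({ω | n < slotted (U i ω)} ∩ {ω | S.requiredEnergy (slotted (U i ω)) ≤
        S.harvested i (fun τ => h i τ ω) (fun τ => mrt (h i τ ω)) (slotted (U i ω))}) := by
  have hV : Measurable fun ω => slotted (U i ω) :=
    measurable_slotted.comp (hm.measurable_arrival i)
  have hHarv : ∀ v, Measurable fun ω =>
      S.harvested i (fun τ => h i τ ω) (fun τ => mrt (h i τ ω)) v := by
    intro v
    unfold harvested
    refine (Finset.measurable_sum _ fun τ _ => ?_).const_mul _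
    exact (S.measurable_rfPower_mrt i).comp (hm.measurable_channel i τ)
  have hdec := measureReal_lt_eq_one_sub_sum (μ := μ) hV (fun ω => Nat.le_add_left 1 ⌊U i ω⌋₊)
    hHarv S.requiredEnergy n
  rw [outage, hdec, truncatedBound, Finset.mul_sum]
  rw [Finset.sum_congr rfl fun v hv =>
    hm.measureReal_slotted_eq_and_le i (Finset.mem_Icc.1 hv).1]
  simp_rw [mul_assoc]
  ring

lemma IsPoissonModel.outage_le_truncatedBound (hm : S.IsPoissonModel h U μ) (i : ι) (n : ℕ) :
    S.outage h U μ (fun τ ω => mrt (h i τ ω)) i ≤ S.truncatedBound i n := by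
  rw [hm.truncatedBound_eq]
  exact le_add_of_nonneg_right measureReal_nonneg

lemma IsPoissonModel.truncatedBound_le (hm : S.IsPoissonModel h U μ) (i : ι) (n : ℕ) :
    S.truncatedBound i n ≤
      S.outage h U μ (fun τ ω => mrt (h i τ ω)) i + Real.exp (-S.lam * n) := by
  rw [hm.truncatedBound_eq, ← measureReal_lt_slotted S.lam_pos (hm.measurable_arrival i)
    (hm.law_arrival i)]
  exact add_le_add_right (measureReal_mono Set.inter_subset_left) _

lemma IsPoissonModel.tendsto_truncatedBound (hm : S.IsPoissonModel h U μ) (i : ι) :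
    Tendsto (S.truncatedBound i) atTop (𝓝 (S.outage h U μ (fun τ ω => mrt (h i τ ω)) i)) := by
  refine tendsto_of_tendsto_of_tendsto_of_le_of_le tendsto_const_nhds ?_
    (hm.outage_le_truncatedBound i) (hm.truncatedBound_le i)
  have h1 : Tendsto (fun n : ℕ => Real.exp (-S.lam * n)) atTop (𝓝 0) :=
    Real.tendsto_exp_atBot.comp
      (tendsto_natCast_atTop_atTop.const_mul_atTop_of_neg (neg_lt_zero.2 S.lam_pos))
  simpa using h1.const_add (S.outage h U μ (fun τ ω => mrt (h i τ ω)) i)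

end Model

end Network

/-- The truncation level `10 e^λ / (e^λ - 1)` is at least `10 / λ`, because `1 - e^(-λ) ≤ λ`. -/
lemma ten_le_mul_of_le {l x : ℝ} (hl : 0 < l)
    (hx : 10 * (Real.exp l / (Real.exp l - 1)) ≤ x) : 10 ≤ l * x := by
  have h1 : 0 < Real.exp l - 1 := sub_pos.2 (Real.one_lt_exp_iff.2 hl)
  have h2 : Real.exp l - 1 ≤ l * Real.exp l := by
    have h := mul_le_mul_of_nonneg_right (Real.add_one_le_exp (-l)) (Real.exp_pos l).le
    rw [← Real.exp_add, neg_add_cancel, Real.exp_zero] at h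
    linarith
  calc (10 : ℝ) ≤ l * (10 * (Real.exp l / (Real.exp l - 1))) := by
        rw [← mul_assoc, ← mul_div_assoc, le_div_iff₀ h1]; linarith
    _ ≤ l * x := by gcongr

end WPCN

theorem theorem1 {ι Ω : Type*} [Finite ι] [MeasurableSpace Ω] (μ : Measure Ω)
    [IsProbabilityMeasure μ] (S : WPCN.Network ι)
    (h : ι → ℕ → Ω → EuclideanSpace ℂ (Fin S.Mt)) (U : ι → Ω → ℝ)
    (hmodel : S.IsPoissonModel h U μ)
    -- the node under the greatest path loss
    (i₀ : ι) (hi₀ : ∀ i, S.β i₀ ≤ S.β i) :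
    -- law of the inter-arrival count
    (∀ i, ∀ v : ℕ, 1 ≤ v →
      μ.real {ω | WPCN.slotted (U i ω) = v} =
        (Real.exp S.lam - 1) * Real.exp (-S.lam * v)) ∧
    -- under MRT towards `i₀`, the harvested energy is a random sum of independent scaled
    -- non-central chi-squared variables, independent of the number of summands
    (∀ ω, S.harvested i₀ (fun τ => h i₀ τ ω) (fun τ => WPCN.mrt (h i₀ τ ω))
        (WPCN.slotted (U i₀ ω)) =
      S.η * S.Tc * ∑ τ ∈ Finset.range (WPCN.slotted (U i₀ ω)),
        S.rfPower i₀ (h i₀ τ ω) (WPCN.mrt (h i₀ τ ω))) ∧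
    (∀ τ, μ.map (fun ω => S.rfPower i₀ (h i₀ τ ω) (WPCN.mrt (h i₀ τ ω))) =
      (WPCN.noncentralChiSq (2 * S.Mt) (2 * S.Mt * S.κ)).map
        (fun x => S.P * S.β i₀ / (2 * (1 + S.κ)) * x)) ∧
    iIndepFun (fun τ ω => S.rfPower i₀ (h i₀ τ ω) (WPCN.mrt (h i₀ τ ω))) μ ∧
    IndepFun (fun ω => WPCN.slotted (U i₀ ω))
      (fun ω τ => S.rfPower i₀ (h i₀ τ ω) (WPCN.mrt (h i₀ τ ω))) μ ∧
    -- MRT towards `i₀` attains the smallest outage probability of `i₀` over all precoders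
    IsLeast {o : ℝ | ∃ w, WPCN.IsPrecoder w ∧ o = S.outage h U μ w i₀}
      (S.outage h U μ (fun τ ω => WPCN.mrt (h i₀ τ ω)) i₀) ∧
    -- the truncated expression converges to that smallest outage probability
    Tendsto (S.truncatedBound i₀) atTop
      (𝓝 (S.outage h U μ (fun τ ω => WPCN.mrt (h i₀ τ ω)) i₀)) ∧
    (∀ vmax : ℕ,
      S.outage h U μ (fun τ ω => WPCN.mrt (h i₀ τ ω)) i₀ ≤ S.truncatedBound i₀ vmax ∧
      S.truncatedBound i₀ vmax ≤
        S.outage h U μ (fun τ ω => WPCN.mrt (h i₀ τ ω)) i₀ + Real.exp (-S.lam * vmax)) ∧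
    -- lower bounds on the worst-node outage probability under arbitrary precoders
    (∀ w, WPCN.IsPrecoder w →
      S.outage h U μ (fun τ ω => WPCN.mrt (h i₀ τ ω)) i₀ ≤ ⨆ i, S.outage h U μ w i ∧
      (∀ vmax : ℕ,
        S.truncatedBound i₀ vmax - Real.exp (-S.lam * vmax) ≤ ⨆ i, S.outage h U μ w i) ∧
      (∀ vmax : ℕ, 10 * (Real.exp S.lam / (Real.exp S.lam - 1)) ≤ vmax →
        S.truncatedBound i₀ vmax - Real.exp (-10) ≤ ⨆ i, S.outage h U μ w i)) := by
  have hmin : ∀ w, WPCN.IsPrecoder w →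
      S.outage h U μ (fun τ ω => WPCN.mrt (h i₀ τ ω)) i₀ ≤ ⨆ i, S.outage h U μ w i := fun w hw =>
    (S.outage_mrt_le μ h U hw i₀).trans
      (le_ciSup (f := fun i => S.outage h U μ w i) (Set.finite_range _).bddAbove i₀)
  refine ⟨fun i v hv => WPCN.measureReal_slotted_eq S.lam_pos (hmodel.measurable_arrival i)
      (hmodel.law_arrival i) hv, fun ω => rfl,
    fun τ => S.map_rfPower_mrt i₀ (hmodel.measurable_channel i₀ τ) (hmodel.law_channel i₀ τ),
    ?_, ?_, ⟨⟨_, WPCN.isPrecoder_mrt (hmodel.measurable_channel i₀), rfl⟩, ?_⟩,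
    hmodel.tendsto_truncatedBound i₀,
    fun n => ⟨hmodel.outage_le_truncatedBound i₀ n, hmodel.truncatedBound_le i₀ n⟩,
    fun w hw => ⟨hmin w hw, fun n => ?_, fun n hn => ?_⟩⟩
  · exact (hmodel.indep_channel i₀).comp _ fun _ => S.measurable_rfPower_mrt i₀
  · exact (hmodel.indep_arrival i₀).comp WPCN.measurable_slotted
      (measurable_pi_lambda _ fun τ => (S.measurable_rfPower_mrt i₀).comp (measurable_pi_apply τ))
  · rintro _ ⟨w, hw, rfl⟩
    exact S.outage_mrt_le μ h U hw i₀
  · have := hmodel.truncatedBound_le i₀ n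
    have := hmin w hw
    linarith
  · have h1 := hmodel.truncatedBound_le i₀ n
    have h2 := hmin w hw
    have h3 : Real.exp (-S.lam * n) ≤ Real.exp (-10) := by
      have := WPCN.ten_le_mul_of_le S.lam_pos hn
      rw [Real.exp_le_exp]
      linarith
    linarith
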